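/- **Setting.** Consider the control-affine system $x_{t+1}=f(x_t)+g(x_t)u_t$ with state space $\mathcal X=\mathbb R^{d_x}$, inputs in a set $\mathcal U\subseteq\mathbb R^{d_u}$, an arbitrary norm $\|\cdot\|$ on $\mathbb R^{d_u}$, and $f$, $g$ measurable. For a time-varying controller $\pi=(\pi_0,\pi_1,\dots)$ let $\varphi_t(x_0;\pi_{0:t-1})$ be the state at time $t$ when the initial state is $x_0$ and $u_s=\pi_s(x_s)$. Let $\mathcal D$ be a probability measure on $\mathcal X$ (the law of the initial state), and let $\Pi$ be a possibly infinite class of controllers $\pi:\mathcal X\to\mathcal U$ that contains the (measurable) expert $\pi_\star$. Put $B_u:=\sup_{u\in\mathcal U}\|u\|$. **Forward.** Given $n$ and $T$, let $c:=\sum_{t\ge 1}\frac{1}{t\ln^2(t+1)}$ and $n_t:=\big\lceil c\,n\,t\,\lceil \ln^2(t+1)\rceil\big\rceil+n$ (so $n_0=n$). For $t=0,\dots,T-1$, sample fresh initial states $x_0^{(1)},\dots,x_0^{(n_t)}$ i.i.d. from $\mathcal D$, compute $\hat x_t^{(i)}:=\varphi_t(x_0^{(i)};\hat\pi_{0:t-1})$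 with the controllers learned in the previous stages, and select $$\hat\pi_t\in\operatorname*{arg\,min}_{\pi\in\Pi}\ \frac1{n_t}\sum_{i=1}^{n_t}\|\pi_\star(\hat x_t^{(i)})-\pi(\hat x_t^{(i)})\| .$$ The selection may be any rule that depends on the samples of stages $0,\dots,t$ and on independent internal randomness, and for which $\hat\pi_t(x)$ is jointly measurable in the training data, the internal randomness and $x$. **Growth function.** For a class $\mathcal F$ of functions on $\mathcal X$ with values in $\mathbb R^{d_u}$, $m\in\mathbb N$ and a radius $\varepsilon$, let $\mathcal N_\infty(\varepsilon,\mathcal F,m):=\sup_{x\in\mathcal X^m}\mathcal N(\varepsilon,\mathcal F(x),\|\cdot\|_\infty)$, where $\mathcal F(x)=\{(h(x_1),\dots,h(x_m)):h\in\mathcal F\}$, $\|v\|_\infty=\max_i\|v_i\|$, and $\mathcal N(\varepsilon,A,\|\cdot\|_\infty)$ is the least number of closed $\varepsilon$-balls centred at points of $A$ that cover $A$. **Lemma.** Let $\delta\in(0,1)$, $n\ge 16$, $T\ge 0$, and $$\mathcal M(n):=10\,\mathcal N_\infty\!\Big(\frac{\min\{1,2B_u\}}{n},\,\Pi,\,2n\Big),$$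 that is, $\mathcal M(n)=10\,\mathcal N_\infty(1/n,\Pi,2n)$ whenever $B_u\ge\frac12$. Then with probability at least $1-T\delta$ over the training process, the controller $\hat\pi_{0:T-1}$ produced by Forward satisfies $$\forall t\in\{0,\dots,T-1\}:\qquad \mathbb E\big[\|\pi_\star(\hat x_t)-\hat\pi_t(\hat x_t)\|\ \big|\ \hat\pi_{0:T-1}\big]\ \le\ \frac{30\,B_u\ln(\mathcal M(n)/\delta)}{n-1},$$ where $\hat x_t=\varphi_t(x_0;\hat\pi_{0:t-1})$ and the expectation is over a new initial state $x_0\sim\mathcal D$. (If $B_u>0$ and $B_u$ or $\mathcal M(n)$ is infinite, the right-hand side is $+\infty$; if $B_u=0$, it is $0$.) -/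

import Mathlib

open MeasureTheory
open scoped ENNReal NNReal

section Dynamics

variable {dx : ℕ} {E : Type*} [NormedAddCommGroup E] [NormedSpace ℝ E]

/-- The state `φ_t(x₀; π_{0:t-1})` at time `t` of the control-affine system
`x_{t+1} = f(x_t) + g(x_t) u_t` under the time-varying feedback `u_s = π_s(x_s)`.
It depends on `π_0, …, π_{t-1}` only. -/
noncomputable def closedLoopState
    (f : EuclideanSpace ℝ (Fin dx) → EuclideanSpace ℝ (Fin dx))
    (g : EuclideanSpace ℝ (Fin dx) → (E →ₗ[ℝ] EuclideanSpace ℝ (Fin dx)))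
    (π : ℕ → EuclideanSpace ℝ (Fin dx) → E) :
    ℕ → EuclideanSpace ℝ (Fin dx) → EuclideanSpace ℝ (Fin dx)
  | 0, x₀ => x₀
  | t + 1, x₀ =>
      f (closedLoopState f g π t x₀) +
        g (closedLoopState f g π t x₀) (π t (closedLoopState f g π t x₀))

end Dynamics

/-- The constant `c = ∑_{t ≥ 1} 1 / (t ln²(t+1))` (the summation index is shifted by one). -/
noncomputable def forwardConst : ℝ :=
  ∑' t : ℕ, 1 / (((t : ℝ) + 1) * Real.log ((t : ℝ) + 2) ^ 2)

/-- The series defining `forwardConst` converges. -/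
theorem summable_forwardConst :
    Summable fun t : ℕ => 1 / (((t : ℝ) + 1) * Real.log ((t : ℝ) + 2) ^ 2) := by
  have hl : ∀ x : ℝ, 2 ≤ x → 0 < Real.log x := fun x hx => Real.log_pos (by linarith)
  set F : ℕ → ℝ := fun t => 1 / ((t : ℝ) * Real.log ((t : ℝ) + 1) ^ 2) with hF
  have key : Summable F := by
    rw [← summable_condensed_iff_of_nonneg]
    · have h2 : Summable fun k : ℕ => 1 / Real.log 2 ^ 2 * (1 / (k : ℝ) ^ 2) :=
        (Real.summable_one_div_nat_pow.mpr one_lt_two).mul_left _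
      refine Summable.of_nonneg_of_le (f := fun k : ℕ => 1 / Real.log 2 ^ 2 * (1 / ((k:ℕ) : ℝ) ^ 2) + if k = 0 then F 1 else 0) ?_ ?_ ?_
      · intro k; simp only [hF]; positivity
      · intro k
        rcases Nat.eq_zero_or_pos k with rfl | hk
        · simp
        · have hk' : (0:ℝ) < k := by exact_mod_cast hk
          have h1 : (k : ℝ) * Real.log 2 ≤ Real.log ((2:ℝ) ^ k + 1) := by
            rw [← Real.log_pow]
            exact Real.log_le_log (by positivity) (by linarith)
          have h3 := hl 2 le_rfl
          simp only [hF, hk.ne', if_false, add_zero]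
          push_cast
          have e : (2:ℝ) ^ k * (1 / (2 ^ k * Real.log (2 ^ k + 1) ^ 2)) =
              1 / Real.log (2 ^ k + 1) ^ 2 := by
            rw [one_div, mul_inv, mul_inv_cancel_left₀ (by positivity), one_div]
          rw [e, one_div_mul_one_div, ← mul_pow]
          apply one_div_le_one_div_of_le (by positivity)
          apply pow_le_pow_left₀ (by positivity)
          linarith
      · refine h2.add (summable_of_ne_finset_zero (s := {0}) ?_)
        intro b hb
        simp at hb
        simp [hb]
    · intro k; simp only [hF]; positivity
    · intro m k hm hmk
      have hm' : (1:ℝ) ≤ m := by exact_mod_cast hm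
      have hmk' : (m:ℝ) ≤ k := by exact_mod_cast hmk
      have := hl (m+1) (by linarith)
      simp only [hF]
      gcongr
  refine ((summable_nat_add_iff 1).mpr key).congr ?_
  intro t
  simp only [hF]
  push_cast
  ring_nf

/-- The number `n_t = c n t ⌈ln²(t+1)⌉ + n` of initial states sampled at stage `t`, rounded up to an
integer; in particular `n_0 = n`. -/
noncomputable def stageSize (n t : ℕ) : ℕ :=
  ⌈forwardConst * n * t * (⌈Real.log ((t : ℝ) + 1) ^ 2⌉₊ : ℝ)⌉₊ + n

/-- All initial states sampled in the stages `0, …, T - 1`: at stage `t` there are `n_t` of them. -/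
abbrev TrainingData (dx n T : ℕ) : Type :=
  (t : Fin T) → Fin (stageSize n t) → EuclideanSpace ℝ (Fin dx)

/-- The law of the training data: all initial states, within a stage and across stages, are drawn
independently from `D`. -/
noncomputable def trainingLaw {dx : ℕ} (D : Measure (EuclideanSpace ℝ (Fin dx)))
    [IsProbabilityMeasure D] (n T : ℕ) : Measure (TrainingData dx n T) :=
  Measure.pi fun t : Fin T => Measure.pi fun _ : Fin (stageSize n t) => D

/-- The empirical imitation risk `(1/m) ∑ i, ‖π⋆(x_i) - π(x_i)‖` of `π` on the states `x_i`. -/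
noncomputable def empiricalRisk {dx : ℕ} {E : Type*} [NormedAddCommGroup E] {m : ℕ}
    (expert : EuclideanSpace ℝ (Fin dx) → E) (x : Fin m → EuclideanSpace ℝ (Fin dx))
    (π : EuclideanSpace ℝ (Fin dx) → E) : ℝ :=
  (1 / (m : ℝ)) * ∑ i, ‖expert (x i) - π (x i)‖

/-- `learned` is an implementation of the forward training algorithm with horizon `T` and sample
parameter `n`: `learned t ξ S` is the controller `π̂_t` computed from the training data `S` and the
internal randomness `ξ` (used for breaking ties between minimizers, if at all).
Only the stages `t < T` matter. -/
structure IsForward {dx : ℕ} {E : Type*} [NormedAddCommGroup E] [NormedSpace ℝ E]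
    [MeasurableSpace E] {Ξ : Type*} [MeasurableSpace Ξ]
    (f : EuclideanSpace ℝ (Fin dx) → EuclideanSpace ℝ (Fin dx))
    (g : EuclideanSpace ℝ (Fin dx) → (E →ₗ[ℝ] EuclideanSpace ℝ (Fin dx)))
    (Pol : Set (EuclideanSpace ℝ (Fin dx) → E)) (expert : EuclideanSpace ℝ (Fin dx) → E)
    (n T : ℕ) (learned : ℕ → Ξ → TrainingData dx n T → EuclideanSpace ℝ (Fin dx) → E) :
    Prop where
  /-- The controller is a random measurable function. -/
  measurable_learned : ∀ t < T,
    Measurable fun p : Ξ × TrainingData dx n T × EuclideanSpace ℝ (Fin dx) =>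
      learned t p.1 p.2.1 p.2.2
  /-- `π̂_t` is computed from the samples of the stages `0, …, t`, so that the samples of stage `t`
  are fresh for `π̂_0, …, π̂_{t-1}`. -/
  nonanticipating : ∀ t < T, ∀ (ξ : Ξ) (S S' : TrainingData dx n T),
    (∀ s : Fin T, (s : ℕ) ≤ t → S s = S' s) → learned t ξ S = learned t ξ S'
  /-- `π̂_t` belongs to the class `Π`. -/
  mem_class : ∀ t < T, ∀ (ξ : Ξ) (S : TrainingData dx n T), learned t ξ S ∈ Pol
  /-- `π̂_t` minimizes over `Π` the empirical risk on the states `x̂_t^{(i)} = φ_t(x₀^{(i)}; π̂_{0:t-1})`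
  reached from the samples of stage `t` under the controllers learned before. -/
  empirical_risk_min : ∀ (t : Fin T) (ξ : Ξ) (S : TrainingData dx n T),
    ∀ π ∈ Pol,
      empiricalRisk expert
          (fun i => closedLoopState f g (fun s => learned s ξ S) t (S t i)) (learned t ξ S) ≤
        empiricalRisk expert
          (fun i => closedLoopState f g (fun s => learned s ξ S) t (S t i)) π

/-- The growth function `N_∞(ε, F, m) = sup_{x ∈ X^m} N(ε, F(x), ‖·‖_∞)` of a class `F` of functions
`X → E`, where `F(x) = {(h(x_1), …, h(x_m)) : h ∈ F}`, the norm on `E^m` is `max_i ‖v_i‖`, and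
`N(ε, A, ‖·‖_∞)` is the least number of closed `ε`-balls centred in `A` that cover `A`. -/
noncomputable def growthFunction {X E : Type*} [NormedAddCommGroup E]
    (ε : ℝ≥0) (F : Set (X → E)) (m : ℕ) : ℕ∞ :=
  ⨆ x : Fin m → X, Metric.coveringNumber ε ((fun (h : X → E) (i : Fin m) => h (x i)) '' F)

/-- `B_u = sup_{u ∈ U} ‖u‖`, with value `∞` if `U` is unbounded. -/
noncomputable def inputBound {E : Type*} [NormedAddCommGroup E] (U : Set E) : ℝ≥0∞ :=
  ⨆ u ∈ U, ‖u‖ₑ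

/-- `M(n) = 10 N_∞(min(1, 2 B_u) / n, Π, 2n)`. The scale is `1 / n` as soon as `B_u ≥ 1 / 2`. -/
noncomputable def growthFactor {X E : Type*} [NormedAddCommGroup E]
    (U : Set E) (Pol : Set (X → E)) (n : ℕ) : ℝ≥0∞ :=
  10 * ((growthFunction ((min 1 (2 * inputBound U)).toNNReal / n) Pol (2 * n) : ℕ∞) : ℝ≥0∞)

/-- The expected imitation error `𝔼 ‖π⋆(x̂_t) - π_t(x̂_t)‖` at time `t`, where
`x̂_t = φ_t(x₀; π_{0:t-1})` and the initial state `x₀` has law `D`. -/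
noncomputable def expectedImitationError {dx : ℕ} {E : Type*} [NormedAddCommGroup E]
    [NormedSpace ℝ E] (D : Measure (EuclideanSpace ℝ (Fin dx)))
    (f : EuclideanSpace ℝ (Fin dx) → EuclideanSpace ℝ (Fin dx))
    (g : EuclideanSpace ℝ (Fin dx) → (E →ₗ[ℝ] EuclideanSpace ℝ (Fin dx)))
    (expert : EuclideanSpace ℝ (Fin dx) → E)
    (π : ℕ → EuclideanSpace ℝ (Fin dx) → E) (t : ℕ) : ℝ≥0∞ :=
  ∫⁻ x₀, ‖expert (closedLoopState f g π t x₀) - π t (closedLoopState f g π t x₀)‖ₑ ∂D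

/-! The expert belongs to the class, so each empirical minimizer has zero empirical risk and agrees
with the expert at every sampled state. The earlier controllers do not depend on the samples of
stage `t`. Conditionally on the internal randomness and on all other stages, stage `t` is therefore
an i.i.d. learning problem in the realizable case, which is why the rate is `1/n` rather than
`1/√n`.

In that problem the normalized loss `‖π⋆ - π̂‖ / (2 B_u)` takes values in `[0, 1]` and vanishes on
the sample. Suppose that its mean exceeds `15 L / n`, with `L = ln(M/δ)`. By Chebyshev, its sum over
an independent ghost sample is then at least `15 L / 2` with probability at least one half
(`half_le_pi_sum_ge`). Exchanging any sample point with its ghost preserves the joint law, so it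
suffices to count, for fixed pairs, the swaps that put a zero-loss sample opposite a large-loss
ghost sample.

The class is replaced by a cover at scale `1/n` on the `2n` points. A cover element that is large on
one point of `k` pairs dictates the swap on those pairs and leaves a fraction of at most `2^(-k)` of
all swaps (`card_swaps_le`). Summing over the cover bounds the joint event, and hence the stage
failure by `δ` (`pi_integral_gt_le_of_realizable`). A union bound over the `T` stages finishes the
proof. -/

/-! ### Swaps of sample and ghost sample, and their counting. -/

section Symmetrization

variable {X ι : Type*}

/-- Exchange the `i`-th sample with the `i`-th ghost sample for those `i` with `σ i = true`. -/
def swapSamples (σ : ι → Bool) (w : (ι → X) × (ι → X)) : (ι → X) × (ι → X) :=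
  (fun i => if σ i then w.2 i else w.1 i, fun i => if σ i then w.1 i else w.2 i)

/-- Regrouped as a family of pairs, the measure is a product of copies of `P.prod P`, each invariant
under exchanging its two factors. -/
theorem measurePreserving_swapSamples [MeasurableSpace X] [Fintype ι] (P : Measure X)
    [IsProbabilityMeasure P] (σ : ι → Bool) :
    MeasurePreserving (swapSamples (X := X) σ)
      ((Measure.pi fun _ : ι => P).prod (Measure.pi fun _ : ι => P))
      ((Measure.pi fun _ : ι => P).prod (Measure.pi fun _ : ι => P)) := by
  have e := measurePreserving_arrowProdEquivProdArrow X X ι (fun _ => P) (fun _ => P)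
  have h : ∀ i : ι, MeasurePreserving (fun z : X × X => if σ i then z.swap else z)
      (P.prod P) (P.prod P) := by
    intro i
    cases σ i
    · exact MeasurePreserving.id (P.prod P)
    · simpa using Measure.measurePreserving_swap (μ := P) (ν := P)
  have hp := measurePreserving_pi (fun _ : ι => P.prod P) (fun _ : ι => P.prod P) h
  have := (e.comp hp).comp e.symm
  convert! this using 1
  funext w
  refine Prod.ext (funext fun i => ?_) (funext fun i => ?_) <;>
  · simp only [swapSamples, Function.comp, MeasurableEquiv.arrowProdEquivProdArrow,
      Equiv.arrowProdEquivProdArrow, MeasurableEquiv.symm, MeasurableEquiv.coe_mk, Equiv.symm,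
      Equiv.coe_fn_mk]
    cases σ i <;> simp

/-- If every sample is moved into `B` by at most a fraction `q` of all swaps, then `B` has
probability at most `q`. -/
theorem prod_pi_le_of_card_swapSamples_le [MeasurableSpace X] [Fintype ι] (P : Measure X)
    [IsProbabilityMeasure P] {B : Set ((ι → X) × (ι → X))} (hB : MeasurableSet B) (q : ℝ)
    (h : ∀ w, (Nat.card {σ : ι → Bool | swapSamples σ w ∈ B} : ℝ) ≤ q * 2 ^ Fintype.card ι) :
    ((Measure.pi fun _ : ι => P).prod (Measure.pi fun _ : ι => P)) B ≤ ENNReal.ofReal q := by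
  classical
  set μ := (Measure.pi fun _ : ι => P).prod (Measure.pi fun _ : ι => P) with hμ
  -- Every swap contributes the same integral `μ B`, so averaging over all swaps moves the estimate
  -- to a count at a fixed `w`.
  have h1 : ∀ σ : ι → Bool, ∫⁻ w, B.indicator 1 (swapSamples σ w) ∂μ = μ B := by
    intro σ
    rw [(measurePreserving_swapSamples P σ).lintegral_comp (measurable_one.indicator hB),
      lintegral_indicator_one hB]
  have h2 : ∫⁻ w, ∑ σ : ι → Bool, B.indicator 1 (swapSamples σ w) ∂μ =
      2 ^ Fintype.card ι * μ B := by
    rw [lintegral_finsetSum]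
    · simp [h1]
    · intro σ _
      exact (measurable_one.indicator hB).comp (measurePreserving_swapSamples P σ).measurable
  have h3 : ∫⁻ w, ∑ σ : ι → Bool, B.indicator 1 (swapSamples σ w) ∂μ ≤
      ∫⁻ _, 2 ^ Fintype.card ι * ENNReal.ofReal q ∂μ := by
    refine lintegral_mono fun w => ?_
    have e : ∑ σ : ι → Bool, B.indicator (1 : (ι → X) × (ι → X) → ℝ≥0∞) (swapSamples σ w) =
        ENNReal.ofReal (Nat.card {σ : ι → Bool | swapSamples σ w ∈ B} : ℝ) := by
      rw [ENNReal.ofReal_natCast]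
      simp only [Set.indicator_apply, Pi.one_apply, Finset.sum_boole]
      congr 1
      rw [Nat.card_eq_fintype_card, Fintype.card_subtype]
      rfl
    rw [e]
    refine (ENNReal.ofReal_le_ofReal (h w)).trans_eq ?_
    rw [mul_comm, ENNReal.ofReal_mul (by positivity), ENNReal.ofReal_pow (by norm_num)]
    simp
  rw [h2, lintegral_const, measure_univ, mul_one] at h3
  exact (ENNReal.mul_le_mul_iff_right (by simp) (by simp)).mp h3

/-- A function that is at most `ε` on one point of each pair and larger on the other forces the
choice of a swap on those pairs. -/
theorem card_swaps_le [Fintype ι] (J : Finset ι) (a b : ι → X) (c : X → ℝ) (ε : ℝ) :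
    Nat.card {σ : ι → Bool | ∀ i ∈ J, c (if σ i then b i else a i) ≤ ε} *
      2 ^ (J.filter fun i => ε < c (a i) ∨ ε < c (b i)).card ≤ 2 ^ Fintype.card ι := by
  classical
  set K := J.filter fun i => ε < c (a i) ∨ ε < c (b i) with hK
  rcases Set.eq_empty_or_nonempty {σ : ι → Bool | ∀ i ∈ J, c (if σ i then b i else a i) ≤ ε}
    with h | ⟨τ, hτ⟩
  · simp [h]
  -- On a pair in `K` the admissible `τ` shows that exactly one of the two values exceeds `ε`, so
  -- every admissible `σ` agrees with `τ` there.
  have hsub : {σ : ι → Bool | ∀ i ∈ J, c (if σ i then b i else a i) ≤ ε} ⊆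
      (Fintype.piFinset fun i => if i ∈ K then {τ i} else (Finset.univ : Finset Bool)) := by
    intro σ hσ
    simp only [Finset.mem_coe, Fintype.mem_piFinset]
    intro i
    by_cases hi : i ∈ K
    · have hi' := hi
      rw [hK, Finset.mem_filter] at hi'
      have h1 := hσ i hi'.1
      have h2 := hτ i hi'.1
      simp only [hi, if_true, Finset.mem_singleton]
      cases hs : σ i <;> cases ht : τ i <;> simp [hs, ht] at h1 h2 ⊢ <;>
        rcases hi'.2 with h | h <;> linarith
    · simp [hi]
  have h1 := Set.ncard_le_ncard hsub (Finset.finite_toSet _)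
  rw [Set.ncard_coe_finset, Fintype.card_piFinset] at h1
  rw [Nat.card_coe_set_eq]
  calc _ ≤ (∏ i, (if i ∈ K then {τ i} else (Finset.univ : Finset Bool)).card) * 2 ^ K.card :=
        Nat.mul_le_mul_right _ h1
    _ = (∏ i, (if i ∈ K then 1 else 2)) * ∏ i, (if i ∈ K then 2 else 1) := by
        congr 1
        · refine Finset.prod_congr rfl fun i _ => ?_
          split_ifs <;> simp
        · rw [Finset.prod_ite_mem]; simp
    _ = 2 ^ Fintype.card ι := by
        rw [← Finset.prod_mul_distrib, ← Finset.card_univ, ← Finset.prod_const]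
        refine Finset.prod_congr rfl fun i _ => ?_
        split_ifs <;> simp

/-- Under a cover by `N` functions at scale `1 / |J|`, few swaps make some member of the class vanish
on the samples while its sum over the ghost samples is at least `s`. -/
theorem card_swaps_realizable_le [Fintype ι] (J : Finset ι) (hJ : J.Nonempty) (a b : ι → X)
    (F : Set (X → ℝ)) (h1 : ∀ h ∈ F, ∀ z, h z ≤ 1)
    (C : Finset (X → ℝ))
    (hC : ∀ h ∈ F, ∃ c ∈ C, ∀ i ∈ J,
      |h (a i) - c (a i)| ≤ 1 / J.card ∧ |h (b i) - c (b i)| ≤ 1 / J.card) (s : ℝ) :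
    (Nat.card {σ : ι → Bool | ∃ h ∈ F, (∀ i ∈ J, h (if σ i then b i else a i) = 0) ∧
        s ≤ ∑ i ∈ J, h (if σ i then a i else b i)} : ℝ) ≤
      C.card * Real.exp (-(Real.log 2 * (s - 2))) * 2 ^ Fintype.card ι := by
  classical
  have hn : (0 : ℝ) < J.card := by exact_mod_cast hJ.card_pos
  set ε : ℝ := 1 / J.card with hε
  set K : (X → ℝ) → Finset ι := fun c => J.filter fun i => ε < c (a i) ∨ ε < c (b i) with hK
  set G := C.filter fun c => s - 2 ≤ (K c).card with hG
  set S : (X → ℝ) → Set (ι → Bool) :=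
    fun c => {σ | ∀ i ∈ J, c (if σ i then b i else a i) ≤ ε} with hS
  have hsub : {σ : ι → Bool | ∃ h ∈ F, (∀ i ∈ J, h (if σ i then b i else a i) = 0) ∧
        s ≤ ∑ i ∈ J, h (if σ i then a i else b i)} ⊆ ⋃ c ∈ G, S c := by
    rintro σ ⟨h, hF, hz, hs⟩
    obtain ⟨c, hcC, hc⟩ := hC h hF
    have hc' : ∀ i ∈ J, ∀ β : Bool, |h (if β then b i else a i) - c (if β then b i else a i)| ≤ ε := by
      intro i hi β
      cases β
      · simpa using (hc i hi).1
      · simpa using (hc i hi).2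
    simp only [Set.mem_iUnion]
    refine ⟨c, ?_, ?_⟩
    · rw [hG, Finset.mem_filter]
      refine ⟨hcC, ?_⟩
      -- On `K c` use `h ≤ 1`. Off it both values of `c` are at most `ε`, so `h ≤ 2ε`, and these
      -- errors sum to at most `2` because `ε = 1/|J|`. Hence `K c` has at least `s - 2` elements.
      have hle : ∑ i ∈ J, h (if σ i then a i else b i) ≤
          ∑ i ∈ J, ((if i ∈ K c then 1 else 0) + 2 * ε) := by
        refine Finset.sum_le_sum fun i hi => ?_
        have hε0 : 0 ≤ ε := by positivity
        by_cases hiK : i ∈ K c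
        · simp only [hiK, if_true]
          linarith [h1 h hF (if σ i then a i else b i)]
        · simp only [hiK, if_false]
          simp only [hK, Finset.mem_filter, hi, true_and, not_or, not_lt] at hiK
          have := hc i hi
          rw [abs_le, abs_le] at this
          cases σ i <;> simp <;> linarith
      rw [Finset.sum_add_distrib, Finset.sum_boole, Finset.sum_const, nsmul_eq_mul] at hle
      have e1 : (J.filter fun i => i ∈ K c) = K c := by
        ext i; simp [hK]
      have e2 : (J.card : ℝ) * (2 * ε) = 2 := by rw [hε]; field_simp
      rw [e1, e2] at hle
      linarith
    · intro i hi
      have := hc' i hi (σ i)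
      rw [hz i hi, abs_le] at this
      linarith
  have hcard : ∀ c ∈ G, ((S c).ncard : ℝ) ≤
      Real.exp (-(Real.log 2 * (s - 2))) * 2 ^ Fintype.card ι := by
    intro c hc
    have h2 : s - 2 ≤ (K c).card := (Finset.mem_filter.mp hc).2
    have h3 := card_swaps_le J a b c ε
    rw [Nat.card_coe_set_eq] at h3
    have h3' : ((S c).ncard : ℝ) * 2 ^ (K c).card ≤ 2 ^ Fintype.card ι := by exact_mod_cast h3
    have h4 : Real.exp (Real.log 2 * (s - 2)) ≤ 2 ^ (K c).card := by
      rw [← Real.rpow_natCast, Real.rpow_def_of_pos (by norm_num)]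
      exact Real.exp_le_exp.mpr (mul_le_mul_of_nonneg_left h2 (Real.log_nonneg (by norm_num)))
    have h5 : ((S c).ncard : ℝ) * Real.exp (Real.log 2 * (s - 2)) ≤ 2 ^ Fintype.card ι :=
      (mul_le_mul_of_nonneg_left h4 (by positivity)).trans h3'
    rw [Real.exp_neg, inv_mul_eq_div, le_div_iff₀ (Real.exp_pos _)]
    exact h5
  rw [Nat.card_coe_set_eq]
  calc _ ≤ ((⋃ c ∈ G, S c).ncard : ℝ) := by
        exact_mod_cast Set.ncard_le_ncard hsub (Set.toFinite _)
    _ ≤ ∑ c ∈ G, ((S c).ncard : ℝ) := by exact_mod_cast Finset.set_ncard_biUnion_le G S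
    _ ≤ ∑ c ∈ G, Real.exp (-(Real.log 2 * (s - 2))) * 2 ^ Fintype.card ι := Finset.sum_le_sum hcard
    _ = G.card * (Real.exp (-(Real.log 2 * (s - 2))) * 2 ^ Fintype.card ι) := by
        rw [Finset.sum_const, nsmul_eq_mul]
    _ ≤ C.card * (Real.exp (-(Real.log 2 * (s - 2))) * 2 ^ Fintype.card ι) := by
        gcongr; exact Finset.filter_subset _ _
    _ = _ := by ring

end Symmetrization

/-! ### Ghost samples and the realizable deviation bound. -/

/-- By Chebyshev's inequality a sum of independent copies of `h` with values in `[0, 1]` and a large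
mean is at least half its mean with probability at least `1 / 2`. -/
theorem half_le_pi_sum_ge {X ι : Type*} [MeasurableSpace X] [Fintype ι] (P : Measure X)
    [IsProbabilityMeasure P] (J : Finset ι) {h : X → ℝ} (hm : Measurable h) (h0 : ∀ z, 0 ≤ h z)
    (h1 : ∀ z, h z ≤ 1) (hp : 8 ≤ J.card * ∫ z, h z ∂P) :
    (1 / 2 : ℝ≥0∞) ≤ Measure.pi (fun _ : ι => P)
      {y | J.card * (∫ z, h z ∂P) / 2 ≤ ∑ i ∈ J, h (y i)} := by
  classical
  set p := ∫ z, h z ∂P with hpdef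
  -- Padding with zero off `J` turns the partial sum into a sum over all coordinates of the product
  -- space.
  set Y : ι → X → ℝ := fun i => if i ∈ J then h else 0 with hY
  have hint : Integrable h P := Integrable.of_bound hm.aestronglyMeasurable 1
    (Filter.Eventually.of_forall fun z => by rw [Real.norm_eq_abs, abs_of_nonneg (h0 z)]; exact h1 z)
  have hL : MemLp h 2 P := MemLp.of_bound hm.aestronglyMeasurable 1
    (Filter.Eventually.of_forall fun z => by rw [Real.norm_eq_abs, abs_of_nonneg (h0 z)]; exact h1 z)
  have hYL : ∀ i, MemLp (Y i) 2 P := by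
    intro i
    by_cases hi : i ∈ J <;> simp [hY, hi, hL]
  have hv : ProbabilityTheory.variance h P ≤ p := by
    refine (ProbabilityTheory.variance_le_expectation_sq hm.aestronglyMeasurable).trans ?_
    refine integral_mono hL.integrable_sq hint fun z => ?_
    simp only [Pi.pow_apply]
    nlinarith [h0 z, h1 z]
  set W : (ι → X) → ℝ := ∑ i, fun y : ι → X => Y i (y i) with hW
  have hWs : ∀ y, W y = ∑ i ∈ J, h (y i) := by
    intro y
    rw [hW, Finset.sum_apply, ← Finset.sum_filter_add_sum_filter_not _ (fun i => i ∈ J)]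
    rw [Finset.sum_eq_zero (s := Finset.univ.filter fun i => i ∉ J), add_zero]
    · refine Finset.sum_congr (by ext; simp) fun i hi => by simp [hY, hi]
    · intro i hi; simp [hY, (Finset.mem_filter.mp hi).2]
  have hvar : ProbabilityTheory.variance W (Measure.pi fun _ : ι => P) ≤ J.card * p := by
    rw [hW, ProbabilityTheory.variance_sum_pi hYL]
    calc _ = ∑ i ∈ J, ProbabilityTheory.variance h P := by
          rw [← Finset.sum_filter_add_sum_filter_not _ (fun i => i ∈ J),
            Finset.sum_eq_zero (s := Finset.univ.filter fun i => i ∉ J), add_zero]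
          · refine Finset.sum_congr (by ext; simp) fun i hi => by simp [hY, hi]
          · intro i hi
            simp [hY, (Finset.mem_filter.mp hi).2, ProbabilityTheory.variance_zero]
      _ ≤ _ := by
          rw [Finset.sum_const, nsmul_eq_mul]
          gcongr
  have hmp : ∀ i : ι, MeasurePreserving (Function.eval i) (Measure.pi fun _ : ι => P) P :=
    fun i => measurePreserving_eval (fun _ : ι => P) i
  have hmean : ∫ y, W y ∂(Measure.pi fun _ : ι => P) = J.card * p := by
    simp_rw [hWs]
    rw [integral_finsetSum]
    · simp_rw [integral_comp_eval (μ := fun _ : ι => P) hm.aestronglyMeasurable]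
      simp [hpdef]
    · intro i _
      exact (hmp i).integrable_comp_of_integrable hint
  have hWL : MemLp W 2 (Measure.pi fun _ : ι => P) := by
    rw [hW]
    exact memLp_finsetSum' _ fun i _ => (hYL i).comp_measurePreserving (hmp i)
  have hc : 0 < J.card * p / 2 := by linarith
  have cheb := ProbabilityTheory.meas_ge_le_variance_div_sq hWL hc
  rw [hmean] at cheb
  have hWm : Measurable W := by
    have : W = fun y => ∑ i ∈ J, h (y i) := funext hWs
    rw [this]; fun_prop
  have hcompl : (Measure.pi fun _ : ι => P) {y | J.card * p / 2 ≤ ∑ i ∈ J, h (y i)}ᶜ ≤ 1 / 2 := by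
    refine (measure_mono ?_).trans (cheb.trans ?_)
    · intro y hy
      simp only [Set.mem_compl_iff, Set.mem_ofPred_eq, not_le, ← hWs] at hy ⊢
      rw [abs_sub_comm]
      exact le_trans (by linarith) (le_abs_self _)
    -- With variance at most `|J| p`, Chebyshev gives `4 / (|J| p)`, and `8 ≤ |J| p`.
    · have : ProbabilityTheory.variance W (Measure.pi fun _ : ι => P) / (J.card * p / 2) ^ 2
          ≤ 1 / 2 := by
        rw [div_le_iff₀ (by positivity)]
        nlinarith
      refine (ENNReal.ofReal_le_ofReal this).trans_eq ?_
      rw [ENNReal.ofReal_div_of_pos (by norm_num)]; simp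
  have hms : MeasurableSet {y : ι → X | J.card * p / 2 ≤ ∑ i ∈ J, h (y i)} := by
    refine measurableSet_le measurable_const (by fun_prop)
  have := prob_add_prob_compl (μ := Measure.pi fun _ : ι => P) hms
  by_contra hlt
  rw [not_le] at hlt
  have h2 := ENNReal.add_lt_add_of_lt_of_le (ne_top_of_le_ne_top (by simp) hcompl) hlt hcompl
  rw [this] at h2
  simp [ENNReal.inv_two_add_inv_two] at h2

/-- Uniform deviation bound in the realizable case, for a data-dependent function `l x` with values
in `[0, 1]` that vanishes on the samples indexed by `J`. -/
theorem pi_integral_gt_le_of_realizable {X ι : Type*} [MeasurableSpace X] [Fintype ι]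
    (P : Measure X) [IsProbabilityMeasure P] (J : Finset ι) (hJ : J.Nonempty)
    (l : (ι → X) → X → ℝ) (hl : Measurable (Function.uncurry l))
    (h0 : ∀ x z, 0 ≤ l x z) (h1 : ∀ x z, l x z ≤ 1) (hz : ∀ x, ∀ i ∈ J, l x (x i) = 0)
    (N : ℕ) (hN : 0 < N)
    (hC : ∀ a b : ι → X, ∃ C : Finset (X → ℝ), C.card ≤ N ∧ ∀ x, ∃ c ∈ C, ∀ i ∈ J,
      |l x (a i) - c (a i)| ≤ 1 / J.card ∧ |l x (b i) - c (b i)| ≤ 1 / J.card)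
    (δ : ℝ) (hδ0 : 0 < δ) (hδ1 : δ < 1) :
    Measure.pi (fun _ : ι => P) {x | 15 * Real.log (10 * N / δ) / J.card < ∫ z, l x z ∂P} ≤
      ENNReal.ofReal δ := by
  set L := Real.log (10 * N / δ) with hL
  have hn : (0 : ℝ) < J.card := by exact_mod_cast hJ.card_pos
  have hN1 : (1 : ℝ) ≤ N := by exact_mod_cast hN
  have hM : 10 ≤ 10 * N / δ := by
    rw [le_div_iff₀ hδ0]; nlinarith
  -- The factor `10` in `M(n)` enters here: `e² < 10`.
  have hL2 : 2 ≤ L := by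
    rw [hL, Real.le_log_iff_exp_le (by linarith)]
    have : Real.exp 2 = Real.exp 1 ^ 2 := by rw [← Real.exp_nat_mul]; norm_num
    nlinarith [Real.exp_one_lt_d9, Real.exp_pos 1]
  set μ := Measure.pi fun _ : ι => P with hμ
  set A : Set (ι → X) := {x | 15 * L / J.card < ∫ z, l x z ∂P} with hA
  have hmint : Measurable fun x => ∫ z, l x z ∂P :=
    (hl.stronglyMeasurable.integral_prod_right (ν := P)).measurable
  have hAm : MeasurableSet A := measurableSet_lt measurable_const hmint
  set s : ℝ := 15 * L / 2 with hs
  -- Only the learned function occurs here, so measurability of a supremum over the class is never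
  -- needed.
  set B : Set ((ι → X) × (ι → X)) := {w | w.1 ∈ A ∧ s ≤ ∑ i ∈ J, l w.1 (w.2 i)} with hB
  have hBm : MeasurableSet B := by
    have hBe : B = Prod.fst ⁻¹' A ∩ {w : (ι → X) × (ι → X) | s ≤ ∑ i ∈ J, l w.1 (w.2 i)} := rfl
    rw [hBe]
    refine (measurable_fst hAm).inter (measurableSet_le measurable_const ?_)
    refine Finset.measurable_sum _ fun i _ => ?_
    exact hl.comp (measurable_fst.prodMk ((measurable_pi_apply i).comp measurable_snd))
  have hlow : μ A * (1 / 2) ≤ (μ.prod μ) B := by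
    rw [Measure.prod_apply hBm]
    calc μ A * (1 / 2) = ∫⁻ x in A, 1 / 2 ∂μ := by rw [setLIntegral_const, mul_comm]
      _ ≤ ∫⁻ x in A, μ (Prod.mk x ⁻¹' B) ∂μ := by
          refine setLIntegral_mono' hAm fun x hx => ?_
          have hx' : 15 * L < J.card * ∫ z, l x z ∂P := by
            have := hx
            rw [hA, Set.mem_ofPred_eq, div_lt_iff₀ hn] at this
            linarith
          refine (half_le_pi_sum_ge P J (hl.comp measurable_prodMk_left) (h0 x) (h1 x)
            (by simp only [Function.comp_def, Function.uncurry]; linarith)).trans (measure_mono ?_)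
          intro y hy
          refine ⟨hx, ?_⟩
          have hy' : J.card * (∫ z, l x z ∂P) / 2 ≤ ∑ i ∈ J, l x (y i) := hy
          simp only [hs]
          linarith
      _ ≤ _ := setLIntegral_le_lintegral _ _
  have hup : (μ.prod μ) B ≤ ENNReal.ofReal (N * Real.exp (-(Real.log 2 * (s - 2)))) := by
    refine prod_pi_le_of_card_swapSamples_le P hBm _ fun w => ?_
    obtain ⟨C, hCN, hCc⟩ := hC w.1 w.2
    -- A swap changes the training sample and hence the learned function, so the count must be
    -- uniform over the range of `l`.
    have key := card_swaps_realizable_le J hJ w.1 w.2 (Set.range l)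
      (by rintro _ ⟨x, rfl⟩; exact h1 x) C (by rintro _ ⟨x, rfl⟩; exact hCc x) s
    refine le_trans ?_ (key.trans ?_)
    · rw [Nat.card_coe_set_eq, Nat.card_coe_set_eq]
      norm_cast
      refine Set.ncard_le_ncard ?_ (Set.toFinite _)
      intro σ hσ
      exact ⟨_, ⟨_, rfl⟩, fun i hi => hz (swapSamples σ w).1 i hi, hσ.2⟩
    · gcongr
  have hδ : N * Real.exp (-(Real.log 2 * (s - 2))) ≤ δ / 2 := by
    have hlog : (0.69 : ℝ) < Real.log 2 := by linarith [Real.log_two_gt_d9]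
    -- Since `s = 15 L / 2`, the exponent is at least `5.175 L - 1.38`, which exceeds `L + 1.6` for
    -- `L ≥ 2`.
    have hexp : Real.exp (-(Real.log 2 * (s - 2))) ≤ Real.exp (-L - 1.6) := by
      refine Real.exp_le_exp.mpr ?_
      have : 0 ≤ s - 2 := by simp only [hs]; linarith
      have h2 : 0.69 * (s - 2) ≤ Real.log 2 * (s - 2) := mul_le_mul_of_nonneg_right hlog.le this
      simp only [hs] at h2 ⊢
      linarith
    have he : Real.exp (-L - 1.6) ≤ Real.exp (-L) := Real.exp_le_exp.mpr (by linarith)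
    have heL : Real.exp (-L) = δ / (10 * N) := by
      rw [Real.exp_neg, hL, Real.exp_log (by linarith), inv_div]
    calc N * Real.exp (-(Real.log 2 * (s - 2))) ≤ N * (δ / (10 * N)) := by
          gcongr; rw [← heL]; linarith
      _ = δ / 10 := by field_simp
      _ ≤ δ / 2 := by linarith
  have hfin : μ A * (1 / 2) ≤ ENNReal.ofReal δ * (1 / 2) := by
    refine hlow.trans (hup.trans ((ENNReal.ofReal_le_ofReal hδ).trans_eq ?_))
    rw [ENNReal.ofReal_div_of_pos (by norm_num), div_eq_mul_inv]; simp
  exact (ENNReal.mul_le_mul_iff_left (by simp) (by simp)).mp hfin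

/-! ### Conditioning on a coordinate, and measurability of the closed loop. -/

/-- Integrating out one coordinate of a product of probability measures. -/
theorem pi_le_of_forall_update_le {κ : Type*} [Fintype κ] [DecidableEq κ] {Y : κ → Type*}
    [∀ i, MeasurableSpace (Y i)] (μ : ∀ i, Measure (Y i)) [∀ i, IsProbabilityMeasure (μ i)] (t : κ)
    {A : Set (∀ i, Y i)} (hA : MeasurableSet A) (q : ℝ≥0∞)
    (h : ∀ S, μ t {y | Function.update S t y ∈ A} ≤ q) : Measure.pi μ A ≤ q := by
  rw [← lintegral_indicator_one hA]
  calc ∫⁻ S, A.indicator 1 S ∂Measure.pi μ ≤ ∫⁻ _, q ∂Measure.pi μ := by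
        refine lintegral_le_of_lmarginal_le {t} (measurable_one.indicator hA) measurable_const ?_
        intro S
        rw [lmarginal_singleton, lmarginal_singleton]
        have hm : MeasurableSet {y | Function.update S t y ∈ A} := (measurable_update S) hA
        have e : ∫⁻ y, A.indicator 1 (Function.update S t y) ∂μ t =
            μ t {y | Function.update S t y ∈ A} := by
          rw [← lintegral_indicator_one hm]; rfl
        beta_reduce
        rw [e]
        simpa using h S
    _ = q := by simp

/-- Expanding `u` in a basis gives a finite sum of measurable coordinates times `g x` at fixed
vectors, so separate measurability suffices. -/
theorem measurable_linearMap_apply {X E F : Type*} [MeasurableSpace X] [NormedAddCommGroup E]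
    [NormedSpace ℝ E] [FiniteDimensional ℝ E] [MeasurableSpace E] [BorelSpace E]
    [NormedAddCommGroup F] [NormedSpace ℝ F] [MeasurableSpace F] [BorelSpace F]
    [SecondCountableTopology F] (g : X → E →ₗ[ℝ] F) (hg : ∀ u, Measurable fun x => g x u) :
    Measurable fun p : X × E => g p.1 p.2 := by
  set b := Module.finBasis ℝ E
  have e : (fun p : X × E => g p.1 p.2) = fun p => ∑ i, b.coord i p.2 • g p.1 (b i) := by
    funext p
    conv_lhs => rw [← b.sum_repr p.2, map_sum]
    simp only [map_smul, Module.Basis.coord_apply]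
  rw [e]
  refine Finset.measurable_sum _ fun i _ => ?_
  have h1 : Measurable fun u : E => b.coord i u :=
    (LinearMap.continuous_of_finiteDimensional (b.coord i)).measurable
  exact (h1.comp measurable_snd).smul ((hg (b i)).comp measurable_fst)

section ClosedLoop

variable {dx : ℕ} {E : Type*} [NormedAddCommGroup E] [NormedSpace ℝ E]
  {f : EuclideanSpace ℝ (Fin dx) → EuclideanSpace ℝ (Fin dx)}
  {g : EuclideanSpace ℝ (Fin dx) → (E →ₗ[ℝ] EuclideanSpace ℝ (Fin dx))}

theorem closedLoopState_congr {π π' : ℕ → EuclideanSpace ℝ (Fin dx) → E} {t : ℕ}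
    (h : ∀ s < t, π s = π' s) : closedLoopState f g π t = closedLoopState f g π' t := by
  induction t with
  | zero => rfl
  | succ t ih =>
    funext x
    simp only [closedLoopState, ih fun s hs => h s (by omega), h t (by omega)]

/-- The parameter `Ω` carries the training randomness, so that the imitation error can be integrated
by Fubini. -/
theorem measurable_closedLoopState [FiniteDimensional ℝ E] [MeasurableSpace E] [BorelSpace E]
    {Ω : Type*} [MeasurableSpace Ω] (hf : Measurable f) (hg : ∀ u : E, Measurable fun x => g x u)
    {π : Ω → ℕ → EuclideanSpace ℝ (Fin dx) → E} {t : ℕ}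
    (h : ∀ s < t, Measurable fun p : Ω × EuclideanSpace ℝ (Fin dx) => π p.1 s p.2) :
    Measurable fun p : Ω × EuclideanSpace ℝ (Fin dx) => closedLoopState f g (π p.1) t p.2 := by
  induction t with
  | zero => exact measurable_snd
  | succ t ih =>
    have hx := ih fun s hs => h s (by omega)
    have hu := (h t (by omega)).comp (measurable_fst.prodMk hx)
    exact (hf.comp hx).add ((measurable_linearMap_apply g hg).comp (hx.prodMk hu))

end ClosedLoop

/-! ### From covers to the imitation error of an interpolating learner. -/

/-- A bound on the growth function yields covers on pairs of tuples of points. -/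
theorem exists_finset_cover_of_growthFunction_le {Z E : Type*} [NormedAddCommGroup E]
    {F : Set (Z → E)} {n : ℕ} {ε : ℝ≥0} {N : ℕ}
    (hN : growthFunction ε F (2 * n) ≤ N) (a b : Fin n → Z) :
    ∃ C : Finset (Z → E), C.card ≤ N ∧ ∀ h ∈ F, ∃ c ∈ C, ∀ i : Fin n,
      ‖h (a i) - c (a i)‖ ≤ ε ∧ ‖h (b i) - c (b i)‖ ≤ ε := by
  classical
  -- Both tuples are listed as one tuple of length `2n`; the `Fin 2` component says which one a
  -- point comes from.
  set z : Fin (2 * n) → Z := fun j =>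
    if (finProdFinEquiv.symm j).1 = 0 then a (finProdFinEquiv.symm j).2
      else b (finProdFinEquiv.symm j).2 with hz
  set ev : (Z → E) → (Fin (2 * n) → E) := fun h i => h (z i) with hev
  have h1 : Metric.coveringNumber ε (ev '' F) ≤ N :=
    (le_iSup (fun x : Fin (2 * n) → Z =>
      Metric.coveringNumber ε ((fun (h : Z → E) (i : Fin (2 * n)) => h (x i)) '' F)) z).trans hN
  obtain ⟨D, hDF, hDfin, hDcov, hDcard⟩ := Metric.exists_set_encard_eq_coveringNumber
    (ne_top_of_le_ne_top (ENat.natCast_ne_top N) h1)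
  have hch : ∀ d ∈ D, ∃ h ∈ F, ev h = d := fun d hd => hDF hd
  choose! r hrF hr using hch
  refine ⟨hDfin.toFinset.image r, ?_, ?_⟩
  · refine Finset.card_image_le.trans ?_
    rw [← hDcard, hDfin.encard_eq_coe_toFinset_card] at h1
    exact_mod_cast h1
  · intro h hh
    obtain ⟨d, hd, hle⟩ := hDcov (Set.mem_image_of_mem ev hh)
    have hle' : edist (ev h) d ≤ ε := hle
    rw [← hr d hd] at hle'
    have hj : ∀ j, ‖h (z j) - r d (z j)‖ ≤ ε := by
      intro j
      have := (edist_le_pi_edist (ev h) (ev (r d)) j).trans hle'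
      rw [edist_nndist] at this
      rw [← dist_eq_norm]
      exact_mod_cast this
    refine ⟨r d, Finset.mem_image_of_mem r (hDfin.mem_toFinset.mpr hd), fun i => ⟨?_, ?_⟩⟩
    · simpa only [hz, Equiv.symm_apply_apply, if_true, one_ne_zero, if_false] using hj (finProdFinEquiv (0, i))
    · simpa only [hz, Equiv.symm_apply_apply, if_true, one_ne_zero, if_false] using hj (finProdFinEquiv (1, i))

/-- Deviation bound for a learner that interpolates the expert on the first `n` samples. -/
theorem pi_imitation_error_gt_le {X Z E : Type*} [MeasurableSpace X] [MeasurableSpace Z]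
    [NormedAddCommGroup E] [MeasurableSpace E] [BorelSpace E] [SecondCountableTopology E]
    (P : Measure X) [IsProbabilityMeasure P] {F : Set (Z → E)} {B : ℝ} (hB : 0 < B)
    (hF : ∀ h ∈ F, ∀ z, ‖h z‖ ≤ B) {expert : Z → E} (hexpert : expert ∈ F)
    (hmeas : Measurable expert) {φ : X → Z} (hφ : Measurable φ) {n m : ℕ} (hn : 0 < n)
    (hnm : n ≤ m) (A : (Fin m → X) → Z → E) (hA : Measurable (Function.uncurry A))
    (hAF : ∀ x, A x ∈ F) (hAz : ∀ x i, A x (φ (x i)) = expert (φ (x i)))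
    {ε : ℝ≥0} (hε : (ε : ℝ) ≤ 2 * B / n) {N : ℕ} (hN0 : 0 < N)
    (hN : growthFunction ε F (2 * n) ≤ N) {δ : ℝ} (hδ0 : 0 < δ) (hδ1 : δ < 1) :
    Measure.pi (fun _ : Fin m => P)
      {x | 30 * B * Real.log (10 * N / δ) / n < ∫ z, ‖expert (φ z) - A x (φ z)‖ ∂P} ≤
      ENNReal.ofReal δ := by
  classical
  have hn' : (0 : ℝ) < n := by exact_mod_cast hn
  -- Only the first `n` of the `m` samples are used, so covers on `2n` points suffice whatever the
  -- stage size.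
  set J : Finset (Fin m) := Finset.univ.map (Fin.castLEEmb hnm) with hJ
  have hJc : J.card = n := by simp [hJ]
  have key := pi_integral_gt_le_of_realizable P J (Finset.card_pos.mp (by omega))
    (fun x z => ‖expert (φ z) - A x (φ z)‖ / (2 * B)) ?_ ?_ ?_ ?_ N hN0 ?_ δ hδ0 hδ1
  · rw [hJc] at key
    refine (measure_mono ?_).trans key
    intro x hx
    simp only [Set.mem_ofPred_eq] at hx ⊢
    rw [integral_div, lt_div_iff₀ (by positivity)]
    refine lt_of_eq_of_lt ?_ hx
    ring
  · have h1 : Measurable fun p : (Fin m → X) × X => φ p.2 := hφ.comp measurable_snd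
    exact ((hmeas.comp h1).sub (hA.comp (measurable_fst.prodMk h1))).norm.div_const _
  · intro x z; positivity
  · intro x z
    rw [div_le_one (by positivity)]
    linarith [norm_sub_le (expert (φ z)) (A x (φ z)), hF _ hexpert (φ z), hF _ (hAF x) (φ z)]
  · intro x i _
    simp [hAz x i]
  · intro a b
    obtain ⟨C, hCN, hC⟩ := exists_finset_cover_of_growthFunction_le hN
      (fun i => φ (a (Fin.castLE hnm i))) (fun i => φ (b (Fin.castLE hnm i)))
    refine ⟨C.image fun c z => ‖expert (φ z) - c (φ z)‖ / (2 * B),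
      Finset.card_image_le.trans hCN, fun x => ?_⟩
    obtain ⟨c, hc, hcle⟩ := hC _ (hAF x)
    refine ⟨_, Finset.mem_image_of_mem _ hc, fun j hj => ?_⟩
    obtain ⟨i, -, rfl⟩ := Finset.mem_map.mp hj
    -- Dividing by `2B` turns the scale `ε ≤ 2B/n` into the required `1/n`.
    have aux : ∀ u v w : E, ‖v - w‖ ≤ ε →
        |‖u - v‖ / (2 * B) - ‖u - w‖ / (2 * B)| ≤ 1 / J.card := by
      intro u v w h
      rw [← sub_div, abs_div, abs_of_pos (show 0 < 2 * B by linarith), hJc,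
        div_le_div_iff₀ (by linarith) hn']
      have h2 : |‖u - v‖ - ‖u - w‖| ≤ ε := by
        refine (abs_norm_sub_norm_le _ _).trans ?_
        rwa [sub_sub_sub_cancel_left, norm_sub_rev]
      rw [le_div_iff₀ hn'] at hε
      nlinarith
    exact ⟨aux _ _ _ (hcle i).1, aux _ _ _ (hcle i).2⟩

/-- A learner that minimizes the empirical risk over a class containing the expert interpolates the
expert on the samples. -/
theorem eq_expert_of_empiricalRisk_le {dx : ℕ} {E : Type*} [NormedAddCommGroup E] {m : ℕ}
    {expert π : EuclideanSpace ℝ (Fin dx) → E} {x : Fin m → EuclideanSpace ℝ (Fin dx)}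
    (h : empiricalRisk expert x π ≤ empiricalRisk expert x expert) (i : Fin m) :
    π (x i) = expert (x i) := by
  have hm : (0 : ℝ) < m := by exact_mod_cast i.pos
  simp only [empiricalRisk, sub_self, norm_zero, Finset.sum_const_zero, mul_zero] at h
  have h2 : ∑ i, ‖expert (x i) - π (x i)‖ ≤ 0 := by
    by_contra hc
    rw [not_le] at hc
    have := mul_pos (one_div_pos.mpr hm) hc
    linarith
  have h3 := Finset.single_le_sum (f := fun i => ‖expert (x i) - π (x i)‖)
    (fun i _ => norm_nonneg _) (Finset.mem_univ i)
  have h4 : ‖expert (x i) - π (x i)‖ ≤ 0 := h3.trans h2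
  exact (sub_eq_zero.mp (norm_le_zero_iff.mp h4)).symm

/-! ### One stage of the algorithm. -/

section Forward

variable {dx : ℕ} {E : Type*} [NormedAddCommGroup E] [NormedSpace ℝ E] [FiniteDimensional ℝ E]
  [MeasurableSpace E] [BorelSpace E]
  {f : EuclideanSpace ℝ (Fin dx) → EuclideanSpace ℝ (Fin dx)}
  {g : EuclideanSpace ℝ (Fin dx) → (E →ₗ[ℝ] EuclideanSpace ℝ (Fin dx))}
  {Pol : Set (EuclideanSpace ℝ (Fin dx) → E)} {expert : EuclideanSpace ℝ (Fin dx) → E}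
  {n T : ℕ} {Ξ : Type*} [MeasurableSpace Ξ]
  {learned : ℕ → Ξ → TrainingData dx n T → EuclideanSpace ℝ (Fin dx) → E}

theorem IsForward.measurable_error (hlearned : IsForward f g Pol expert n T learned)
    (hf : Measurable f) (hg : ∀ u : E, Measurable fun x => g x u) (hmeas : Measurable expert)
    {t : ℕ} (ht : t < T) :
    Measurable fun p : (Ξ × TrainingData dx n T) × EuclideanSpace ℝ (Fin dx) =>
      expert (closedLoopState f g (fun s => learned s p.1.1 p.1.2) t p.2) -
        learned t p.1.1 p.1.2 (closedLoopState f g (fun s => learned s p.1.1 p.1.2) t p.2) := by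
  have := FiniteDimensional.proper_real E
  have hl : ∀ s < T, Measurable
      fun p : (Ξ × TrainingData dx n T) × EuclideanSpace ℝ (Fin dx) =>
        learned s p.1.1 p.1.2 p.2 := fun s hs =>
    (hlearned.measurable_learned s hs).comp MeasurableEquiv.prodAssoc.measurable
  have hx := measurable_closedLoopState (f := f) (g := g) hf hg
    (π := fun p : Ξ × TrainingData dx n T => fun s => learned s p.1 p.2) (t := t)
    fun s hs => hl s (by omega)
  exact (hmeas.comp hx).sub ((hl t ht).comp (measurable_fst.prodMk hx))

/-- The deviation bound for one stage of the algorithm. -/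
theorem IsForward.measure_error_gt_le (hlearned : IsForward f g Pol expert n T learned)
    (hf : Measurable f) (hg : ∀ u : E, Measurable fun x => g x u) (hmeas : Measurable expert)
    (hexpert : expert ∈ Pol) {B : ℝ} (hB : 0 < B) (hPol : ∀ π ∈ Pol, ∀ x, ‖π x‖ ≤ B)
    (D : Measure (EuclideanSpace ℝ (Fin dx))) [IsProbabilityMeasure D]
    (ν : Measure Ξ) [IsProbabilityMeasure ν] (hn : 0 < n)
    {ε : ℝ≥0} (hε : (ε : ℝ) ≤ 2 * B / n) {N : ℕ} (hN0 : 0 < N)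
    (hN : growthFunction ε Pol (2 * n) ≤ N) {δ : ℝ} (hδ0 : 0 < δ) (hδ1 : δ < 1) (t : Fin T) :
    (ν.prod (trainingLaw D n T))
      {p | 30 * B * Real.log (10 * N / δ) / n <
        ∫ z, ‖expert (closedLoopState f g (fun s => learned s p.1 p.2) t z) -
          learned t p.1 p.2 (closedLoopState f g (fun s => learned s p.1 p.2) t z)‖ ∂D} ≤
      ENNReal.ofReal δ := by
  classical
  have := FiniteDimensional.proper_real E
  have : IsProbabilityMeasure (trainingLaw D n T) := by unfold trainingLaw; infer_instance
  set A : Set (Ξ × TrainingData dx n T) := {p | 30 * B * Real.log (10 * N / δ) / n <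
        ∫ z, ‖expert (closedLoopState f g (fun s => learned s p.1 p.2) t z) -
          learned t p.1 p.2 (closedLoopState f g (fun s => learned s p.1 p.2) t z)‖ ∂D} with hA
  have hAm : MeasurableSet A := by
    refine measurableSet_lt measurable_const ?_
    exact ((hlearned.measurable_error hf hg hmeas
      t.2).norm.stronglyMeasurable.integral_prod_right (ν := D)).measurable
  rw [Measure.prod_apply hAm]
  refine (lintegral_mono (g := fun _ => ENNReal.ofReal δ) fun ξ => ?_).trans_eq (by simp)
  refine pi_le_of_forall_update_le _ t (measurable_prodMk_left hAm) _ fun S => ?_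
  -- Freshness: resampling stage `t` leaves the earlier controllers unchanged, so the map from
  -- initial state to `x̂_t` is fixed.
  have hcl : ∀ y, closedLoopState f g (fun s => learned s ξ (Function.update S t y)) t =
      closedLoopState f g (fun s => learned s ξ S) t := by
    intro y
    refine closedLoopState_congr fun s hs => ?_
    refine hlearned.nonanticipating s (hs.trans t.2) ξ _ _ fun r hr => ?_
    rw [Function.update_of_ne]
    rintro rfl
    omega
  set φ := closedLoopState f g (fun s => learned s ξ S) t with hφ
  have hφm : Measurable φ := by
    have := measurable_closedLoopState (f := f) (g := g) hf hg
      (π := fun _ : Unit => fun s => learned s ξ S) (t := t) fun s hs =>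
        (hlearned.measurable_learned s (hs.trans t.2)).comp
          (measurable_const.prodMk (measurable_const.prodMk measurable_snd))
    exact this.comp (measurable_const.prodMk measurable_id : Measurable fun x => ((), x))
  refine (measure_mono ?_).trans (pi_imitation_error_gt_le D hB hPol hexpert hmeas hφm hn
    (Nat.le_add_left n _ : n ≤ stageSize n t) (fun y => learned t ξ (Function.update S t y))
    ?_ ?_ ?_ hε hN0 hN hδ0 hδ1)
  · intro y hy
    simp only [hA, Set.mem_ofPred_eq, Set.mem_preimage, hcl] at hy
    exact hy
  · exact (hlearned.measurable_learned t t.2).comp (measurable_const.prodMk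
      (((measurable_update S).comp measurable_fst).prodMk measurable_snd))
  · intro y
    exact hlearned.mem_class t t.2 ξ _
  · intro y i
    have := eq_expert_of_empiricalRisk_le
      (hlearned.empirical_risk_min t ξ (Function.update S t y) expert hexpert) i
    rw [hcl y] at this
    rwa [congrFun (Function.update_self t y S) i] at this

end Forward

/-! ### Degenerate cases and the union bound. -/

theorem growthFunction_pos {X E : Type*} [NormedAddCommGroup E] [Nonempty X] (ε : ℝ≥0)
    {F : Set (X → E)} (hF : F.Nonempty) (m : ℕ) : 0 < growthFunction ε F m := by
  obtain ⟨x⟩ := ‹Nonempty X›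
  refine lt_of_lt_of_le ?_ (le_iSup (fun x : Fin m → X =>
    Metric.coveringNumber ε ((fun (h : X → E) (i : Fin m) => h (x i)) '' F)) fun _ => x)
  exact Metric.coveringNumber_pos_iff.mpr (hF.image _)

theorem enorm_le_inputBound {E : Type*} [NormedAddCommGroup E] {U : Set E} {u : E} (hu : u ∈ U) :
    ‖u‖ₑ ≤ inputBound U :=
  le_iSup₂ (f := fun u (_ : u ∈ U) => ‖u‖ₑ) u hu

/-- The error bound is infinite if the input bound is infinite and the growth factor is at
least `1`, or if the growth factor is infinite and the input bound is positive. -/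
theorem errorBound_eq_top {B M : ℝ≥0∞} {r : ℝ} (hr : 0 < r) (hB : B ≠ 0) (hM : 1 < M)
    (h : B = ⊤ ∨ M = ⊤) : 30 * (B : EReal) * ENNReal.log M / (r : EReal) = ⊤ := by
  have h30 : (0 : EReal) < 30 := by norm_num
  have hBpos : (0 : EReal) < B := by exact_mod_cast pos_iff_ne_zero.mpr hB
  have hlog : 0 < ENNReal.log M := ENNReal.zero_lt_log_iff.mpr hM
  have e : 30 * (B : EReal) * ENNReal.log M = ⊤ := by
    rcases h with rfl | rfl
    · rw [EReal.coe_ennreal_top, EReal.mul_top_of_pos h30, EReal.top_mul_of_pos hlog]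
    · rw [ENNReal.log_top, EReal.mul_top_of_pos (EReal.mul_pos h30 hBpos)]
  rw [e, EReal.top_div_of_pos_ne_top (by exact_mod_cast hr) (EReal.coe_ne_top r)]

theorem mainTheorem6
    {dx : ℕ} {E : Type*} [NormedAddCommGroup E] [NormedSpace ℝ E] [FiniteDimensional ℝ E]
    [MeasurableSpace E] [BorelSpace E]
    (f : EuclideanSpace ℝ (Fin dx) → EuclideanSpace ℝ (Fin dx)) (hf : Measurable f)
    (g : EuclideanSpace ℝ (Fin dx) → (E →ₗ[ℝ] EuclideanSpace ℝ (Fin dx)))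
    (hg : ∀ u : E, Measurable fun x => g x u)
    (U : Set E)
    (Pol : Set (EuclideanSpace ℝ (Fin dx) → E)) (hPol : ∀ π ∈ Pol, ∀ x, π x ∈ U)
    (expert : EuclideanSpace ℝ (Fin dx) → E) (hexpert : expert ∈ Pol)
    (hmeas : Measurable expert)
    (D : Measure (EuclideanSpace ℝ (Fin dx))) [IsProbabilityMeasure D]
    (n T : ℕ) (hn : 16 ≤ n) (δ : ℝ) (hδ0 : 0 < δ) (hδ1 : δ < 1)
    {Ξ : Type*} [MeasurableSpace Ξ] (ν : Measure Ξ) [IsProbabilityMeasure ν]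
    (learned : ℕ → Ξ → TrainingData dx n T → EuclideanSpace ℝ (Fin dx) → E)
    (hlearned : IsForward f g Pol expert n T learned) :
    ENNReal.ofReal (1 - T * δ) ≤
      (ν.prod (trainingLaw D n T))
        {p | ∀ t < T,
          (expectedImitationError D f g expert (fun s => learned s p.1 p.2) t : EReal) ≤
            30 * (inputBound U : EReal) *
                ENNReal.log (growthFactor U Pol n / ENNReal.ofReal δ) /
              (((n : ℝ) - 1 : ℝ) : EReal)} := by
  have : IsProbabilityMeasure (trainingLaw D n T) := by unfold trainingLaw; infer_instance
  have hn' : (16 : ℝ) ≤ n := by exact_mod_cast hn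
  have hall : ∀ {s : Set (Ξ × TrainingData dx n T)}, (∀ p, p ∈ s) →
      ENNReal.ofReal (1 - T * δ) ≤ (ν.prod (trainingLaw D n T)) s := by
    intro s hs
    rw [Set.eq_univ_of_forall hs, measure_univ, ENNReal.ofReal_le_one]
    have : 0 ≤ T * δ := by positivity
    linarith
  rcases eq_or_ne (inputBound U) 0 with hB0 | hB0
  -- The right-hand side is `0` here even if the logarithm is infinite, since `0 * ⊤ = 0` in
  -- `EReal`.
  · refine hall fun p t ht => ?_
    have hzero : ∀ π ∈ Pol, ∀ x, π x = 0 := fun π hπ x => by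
      have := enorm_le_inputBound (hPol π hπ x)
      rw [hB0] at this
      simpa using this
    have : expectedImitationError D f g expert (fun s => learned s p.1 p.2) t = 0 := by
      simp [expectedImitationError, hzero _ hexpert, hzero _ (hlearned.mem_class t ht p.1 p.2)]
    simp [this, hB0]
  set ε : ℝ≥0 := (min 1 (2 * inputBound U)).toNNReal / n with hε
  have hgpos := growthFunction_pos ε ⟨expert, hexpert⟩ (2 * n)
  -- Makes the logarithm strictly positive; otherwise an infinite `B_u` could meet a zero logarithm
  -- and the product would not be `⊤`.
  have hM : 1 < growthFactor U Pol n / ENNReal.ofReal δ := by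
    have h1 : (1 : ℝ≥0∞) ≤ ((growthFunction ε Pol (2 * n) : ℕ∞) : ℝ≥0∞) := by
      exact_mod_cast Order.one_le_iff_pos.mpr hgpos
    have h2 : 1 < growthFactor U Pol n :=
      lt_of_lt_of_le (by norm_num : (1 : ℝ≥0∞) < 10 * 1) (mul_le_mul_right h1 10)
    rw [ENNReal.lt_div_iff_mul_lt (by simp) (by simp), one_mul]
    exact lt_of_le_of_lt (ENNReal.ofReal_le_one.mpr hδ1.le) h2
  by_cases htop : inputBound U = ⊤ ∨ growthFactor U Pol n / ENNReal.ofReal δ = ⊤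
  · refine hall fun p t ht => ?_
    rw [errorBound_eq_top (by linarith) hB0 hM htop]
    exact le_top
  rw [not_or] at htop
  obtain ⟨hBtop, hMtop⟩ := htop
  have hgtop : growthFunction ε Pol (2 * n) ≠ ⊤ := by
    intro h
    apply hMtop
    rw [growthFactor, ← hε, h]
    simp [ENNReal.top_div]
  obtain ⟨N, hN⟩ := ENat.ne_top_iff_exists.mp hgtop
  have hN0 : 0 < N := by rw [← hN] at hgpos; exact_mod_cast hgpos
  have hN1 : (1 : ℝ) ≤ N := by exact_mod_cast hN0
  obtain ⟨b, hb⟩ : ∃ b : ℝ≥0, (b : ℝ≥0∞) = inputBound U :=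
    ⟨_, ENNReal.coe_toNNReal hBtop⟩
  have hb0 : 0 < b := by
    rw [← hb] at hB0
    exact pos_iff_ne_zero.mpr (by simpa using hB0)
  have hPolb : ∀ π ∈ Pol, ∀ x, ‖π x‖ ≤ b := by
    intro π hπ x
    have := enorm_le_inputBound (hPol π hπ x)
    rw [← hb, enorm_le_coe] at this
    exact_mod_cast this
  have hεle : (ε : ℝ) ≤ 2 * b / n := by
    rw [hε, ← hb]
    have : (min 1 (2 * (b : ℝ≥0∞))).toNNReal ≤ 2 * b := by
      refine (ENNReal.toNNReal_mono (by finiteness) (min_le_right _ _)).trans_eq ?_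
      rw [ENNReal.toNNReal_mul, ENNReal.toNNReal_coe, ENNReal.toNNReal_ofNat]
    push_cast
    gcongr
    exact_mod_cast this
  set L := Real.log (10 * N / δ) with hL
  have hL0 : 0 ≤ L := Real.log_nonneg (by rw [le_div_iff₀ hδ0]; linarith)
  have hrhs : 30 * (inputBound U : EReal) *
      ENNReal.log (growthFactor U Pol n / ENNReal.ofReal δ) / (((n : ℝ) - 1 : ℝ) : EReal) =
      ((30 * b * L / (n - 1) : ℝ) : EReal) := by
    have h1 : growthFactor U Pol n / ENNReal.ofReal δ = ENNReal.ofReal (10 * N / δ) := by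
      rw [growthFactor, ← hε, ← hN, ENNReal.ofReal_div_of_pos hδ0,
        ENNReal.ofReal_mul (by norm_num)]
      simp
    rw [h1, ENNReal.log_ofReal_of_pos (by positivity), ← hL, ← hb]
    push_cast
    rfl
  have hmT := fun (t : ℕ) (ht : t < T) => hlearned.measurable_error hf hg hmeas ht
  set A : Fin T → Set (Ξ × TrainingData dx n T) := fun t => {p | 30 * b * L / n <
    ∫ z, ‖expert (closedLoopState f g (fun s => learned s p.1 p.2) t z) -
      learned t p.1 p.2 (closedLoopState f g (fun s => learned s p.1 p.2) t z)‖ ∂D} with hA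
  have hAle : ∀ t, (ν.prod (trainingLaw D n T)) (A t) ≤ ENNReal.ofReal δ := fun t =>
    hlearned.measure_error_gt_le hf hg hmeas hexpert (by exact_mod_cast hb0) hPolb D ν (by omega)
      hεle hN0 hN.symm.le hδ0 hδ1 t
  have hAm : ∀ t, MeasurableSet (A t) := fun t => measurableSet_lt measurable_const
    ((hmT t t.2).norm.stronglyMeasurable.integral_prod_right (ν := D)).measurable
  have hU : (ν.prod (trainingLaw D n T)) (⋃ t, A t) ≤ ENNReal.ofReal (T * δ) := by
    refine (measure_iUnion_fintype_le _ A).trans ((Finset.sum_le_sum fun t _ => hAle t).trans_eq ?_)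
    rw [ENNReal.ofReal_mul (by positivity)]
    simp
  have hsub : (⋃ t, A t)ᶜ ⊆ {p | ∀ t < T,
      (expectedImitationError D f g expert (fun s => learned s p.1 p.2) t : EReal) ≤
        30 * (inputBound U : EReal) * ENNReal.log (growthFactor U Pol n / ENNReal.ofReal δ) /
          (((n : ℝ) - 1 : ℝ) : EReal)} := by
    intro p hp t ht
    rw [hrhs]
    have hle : ∫ z, ‖expert (closedLoopState f g (fun s => learned s p.1 p.2) t z) -
        learned t p.1 p.2 (closedLoopState f g (fun s => learned s p.1 p.2) t z)‖ ∂D ≤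
        30 * b * L / n := by
      by_contra h
      exact hp (Set.mem_iUnion.mpr ⟨⟨t, ht⟩, not_le.mp h⟩)
    -- The bad events use the Bochner integral, which controls the extended error only for an
    -- integrable function.
    have hint : Integrable (fun z =>
        expert (closedLoopState f g (fun s => learned s p.1 p.2) t z) -
        learned t p.1 p.2 (closedLoopState f g (fun s => learned s p.1 p.2) t z)) D := by
      have := FiniteDimensional.proper_real E
      refine Integrable.of_bound
        ((hmT t ht).comp measurable_prodMk_left).aestronglyMeasurable (b + b)
        (Filter.Eventually.of_forall fun z => ?_)
      exact (norm_sub_le _ _).trans (add_le_add (hPolb _ hexpert _)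
        (hPolb _ (hlearned.mem_class t ht p.1 p.2) _))
    rw [expectedImitationError, ← ofReal_integral_norm_eq_lintegral_enorm hint,
      EReal.coe_ennreal_ofReal, max_eq_left (integral_nonneg fun _ => norm_nonneg _)]
    refine EReal.coe_le_coe_iff.mpr (hle.trans ?_)
    gcongr <;> linarith
  refine le_trans ?_ (measure_mono hsub)
  rw [prob_compl_eq_one_sub (MeasurableSet.iUnion hAm), ENNReal.ofReal_sub _ (by positivity),
    ENNReal.ofReal_one]
  exact tsub_le_tsub_left hU 1
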